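/- Let $d,s\ge 0$ be integers, $v\in\mathbb{R}^d$ and $h(x)=\|x-v\|_2^2$. Let $g_1,\dots,g_s\in\mathbb{R}[x_1,\dots,x_d]$ be SOS-convex polynomials, that is, for each $j$ the Hessian satisfies $\nabla^2 g_j(x)=P_j(x)^\top P_j(x)$ for some matrix $P_j$ of polynomials with $d$ columns. Let $\mathcal{D}=\{x\in\mathbb{R}^d : g_j(x)\le 0,\ j=1,\dots,s\}$. Let $\omega$ be the smallest even integer with $\omega\ge 2$ and $\omega\ge\deg g_j$ for all $j$. For $n\ge0$ put $\mathbf{N}_n^d=\{\alpha\in\mathbb{Z}_{\ge0}^d : \alpha_1+\dots+\alpha_d\le n\}$, let $f_\alpha$ denote the coefficient of $x^\alpha$ in a polynomial $f$, and for $\alpha\in\mathbf{N}_\omega^d$ let $B_\alpha$ be the symmetric matrix indexed by $\mathbf{N}_{\omega/2}^d$ with $(B_\alpha)_{\beta\gamma}=1$ if $\beta+\gamma=\alpha$ and $0$ otherwise. Consider the semidefinite programs $$(\mathrm{SDP}_v)\quad \max_{\lambda\in\mathbb{R}_+^s,\ \gamma\in\mathbb{R},\ Q\succeq0}\Big\{\gamma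 : h_\alpha+\sum_{j=1}^s\lambda_j(g_j)_\alpha-\gamma q_\alpha=\mathrm{tr}(QB_\alpha),\ \alpha\in\mathbf{N}_\omega^d\Big\},$$ where $Q$ is a real symmetric matrix indexed by $\mathbf{N}_{\omega/2}^d$, $q_0=1$ and $q_\alpha=0$ for $\alpha\ne0$, and $$(\mathrm{MP}_v)\quad \min_{y\in\mathbb{R}^{\mathbf{N}_\omega^d}}\Big\{\sum_{\alpha\in\mathbf{N}_\omega^d}h_\alpha y_\alpha : \sum_{\alpha\in\mathbf{N}_\omega^d}(g_j)_\alpha y_\alpha\le0,\ j=1,\dots,s,\ \sum_{\alpha\in\mathbf{N}_\omega^d}y_\alpha B_\alpha\succeq0,\ y_0=1\Big\}.$$ Assume that both optimal values are attained and $\max(\mathrm{SDP}_v)=\min(\mathrm{MP}_v)$, and let $y^*$ be an optimal solution of $(\mathrm{MP}_v)$. Then the Euclidean projection of $v$ onto $\mathcal{D}$ is $$P_{\mathcal{D}}(v)=(y^*_{e_1},\dots,y^*_{e_d}),$$ where $e_i$ is the $i$-th unit multi-index; that is, the right-hand side is the unique minimiser of $\|v-x\|_2^2$ over $x\in\mathcal{D}$.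 -/

import Mathlib

namespace SOSProj

open MvPolynomial

noncomputable section

/-- The Hessian of a polynomial, as a matrix of polynomials. -/
def hessian {d : ℕ} (f : MvPolynomial (Fin d) ℝ) :
    Matrix (Fin d) (Fin d) (MvPolynomial (Fin d) ℝ) :=
  Matrix.of fun i j => pderiv i (pderiv j f)

/-- `f` is SOS-convex: its Hessian equals `Pᵀ P` for some `ν × d` polynomial matrix `P`. -/
def IsSOSConvex {d : ℕ} (f : MvPolynomial (Fin d) ℝ) : Prop :=
  ∃ (ν : ℕ) (P : Matrix (Fin ν) (Fin d) (MvPolynomial (Fin d) ℝ)),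
    hessian f = P.transpose * P

/-- The set `{x ∈ ℝ^d : g_j(x) ≤ 0 for all j}`. -/
def feasibleSet {d s : ℕ} (g : Fin s → MvPolynomial (Fin d) ℝ) :
    Set (EuclideanSpace ℝ (Fin d)) :=
  {x | ∀ j, eval (fun i => x i) (g j) ≤ 0}

/-- The minimisers of `x ↦ ‖v - x‖²` over `D`. The equation `P_D(v) = p` means that this set
is `{p}`. -/
def projectionSet {d : ℕ} (D : Set (EuclideanSpace ℝ (Fin d))) (v : EuclideanSpace ℝ (Fin d)) :
    Set (EuclideanSpace ℝ (Fin d)) :=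
  {p | p ∈ D ∧ ∀ x ∈ D, ‖v - p‖ ^ 2 ≤ ‖v - x‖ ^ 2}

/-- The polynomial `h(x) = ‖x - v‖²`. -/
def distSqPoly {d : ℕ} (v : EuclideanSpace ℝ (Fin d)) : MvPolynomial (Fin d) ℝ :=
  ∑ i, (X i - C (v i)) ^ 2

theorem eval_distSqPoly {d : ℕ} (v x : EuclideanSpace ℝ (Fin d)) :
    eval (fun i => x i) (distSqPoly v) = ‖x - v‖ ^ 2 := by
  simp [distSqPoly, EuclideanSpace.norm_sq_eq]

/-- The multi-indices `α ∈ ℕ^d` with `α_1 + ⋯ + α_d ≤ n`. -/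
def multiIdx (d n : ℕ) : Finset (Fin d →₀ ℕ) :=
  (Finset.range (n + 1)).biUnion fun k => Finset.finsuppAntidiag Finset.univ k

theorem mem_multiIdx {d n : ℕ} (α : Fin d →₀ ℕ) :
    α ∈ multiIdx d n ↔ ∑ i, α i ≤ n := by
  simp [multiIdx, Finset.mem_finsuppAntidiag]

theorem zero_mem_multiIdx (d n : ℕ) : (0 : Fin d →₀ ℕ) ∈ multiIdx d n := by
  simp [mem_multiIdx]

theorem single_mem_multiIdx {d n : ℕ} (hn : 2 ≤ n) (i : Fin d) :
    Finsupp.single i 1 ∈ multiIdx d n := by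
  rw [mem_multiIdx, Finset.sum_eq_single i]
  · simp; omega
  · intro j _ hj
    simp [hj.symm]
  · simp

/-- The matrix `B_α`, indexed by the multi-indices of order at most `n`: it is determined by
`(x^β x^γ)_{β,γ} = ∑_α x^α B_α`. -/
def momentBasis {d : ℕ} (n : ℕ) (α : Fin d →₀ ℕ) :
    Matrix (multiIdx d n) (multiIdx d n) ℝ :=
  Matrix.of fun β γ => if (β : Fin d →₀ ℕ) + γ = α then 1 else 0

/-- The Riesz functional `L_y(f) = ∑_{|α| ≤ ω} f_α y_α`. -/
def riesz {d ω : ℕ} (y : multiIdx d ω → ℝ) (f : MvPolynomial (Fin d) ℝ) : ℝ :=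
  ∑ α : multiIdx d ω, coeff (α : Fin d →₀ ℕ) f * y α

/-- The feasible points of the moment program: `L_y(g_j) ≤ 0` for all `j`,
`∑_α y_α B_α ⪰ 0` and `y_0 = 1`. -/
def momentFeasible {d s : ℕ} (g : Fin s → MvPolynomial (Fin d) ℝ) (ω : ℕ) :
    Set (multiIdx d ω → ℝ) :=
  {y | (∀ j, riesz y (g j) ≤ 0) ∧
    (∑ α : multiIdx d ω, y α • momentBasis (ω / 2) (α : Fin d →₀ ℕ)).PosSemidef ∧
    y ⟨0, zero_mem_multiIdx d ω⟩ = 1}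

/-- The objective values of the moment program. -/
def momentValues {d s : ℕ} (g : Fin s → MvPolynomial (Fin d) ℝ)
    (v : EuclideanSpace ℝ (Fin d)) (ω : ℕ) : Set ℝ :=
  (fun y => riesz y (distSqPoly v)) '' momentFeasible g ω

/-- `y` is an optimal solution of the moment program. -/
def IsMomentSolution {d s : ℕ} (g : Fin s → MvPolynomial (Fin d) ℝ)
    (v : EuclideanSpace ℝ (Fin d)) (ω : ℕ) (y : multiIdx d ω → ℝ) : Prop :=
  y ∈ momentFeasible g ω ∧
    ∀ z ∈ momentFeasible g ω, riesz y (distSqPoly v) ≤ riesz z (distSqPoly v)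

/-- The objective values `γ` of the sum-of-squares program: those for which there are `λ ≥ 0` and
`Q ⪰ 0` with `h_α + ∑_j λ_j (g_j)_α - γ q_α = tr(Q B_α)` for all `|α| ≤ ω`, where `q_0 = 1` and
`q_α = 0` for `α ≠ 0`. -/
def sosValues {d s : ℕ} (g : Fin s → MvPolynomial (Fin d) ℝ)
    (v : EuclideanSpace ℝ (Fin d)) (ω : ℕ) : Set ℝ :=
  {γ | ∃ (l : Fin s → ℝ) (Q : Matrix (multiIdx d (ω / 2)) (multiIdx d (ω / 2)) ℝ),
    (∀ j, 0 ≤ l j) ∧ Q.PosSemidef ∧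
    ∀ α ∈ multiIdx d ω,
      coeff α (distSqPoly v) + ∑ j, l j * coeff α (g j) - γ * (if α = 0 then 1 else 0) =
        (Q * momentBasis (ω / 2) α).trace}

end

end SOSProj

/-!
Only the moment program matters. The Riesz functional of a feasible `y` is normalised and
nonnegative on squares of degree at most `ω`, which is all that Jensen's inequality needs of an
expectation when the integrand `f` is SOS-convex. Indeed, with `p` the point of first moments, the
function `t ↦ L (f (p + t (x - p)))` has second derivative `L` of a sum of squares and vanishing
derivative at `t = 0`, so that `f p ≤ L f` by comparing `t = 0` with `t = 1`. Applied to the `g j`,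
this says that `p` is feasible for the original constraints; applied to `h`, it bounds `h p` by the
value of the moment program, which the point masses bound by `h x` for every feasible `x`.
-/

namespace SOSProj

open MvPolynomial Matrix

noncomputable section

section TotalDegree

variable {σ τ R : Type*}

theorem totalDegree_pderiv_le [CommSemiring R] (i : σ) (f : MvPolynomial σ R) :
    (pderiv i f).totalDegree ≤ f.totalDegree - 1 := by
  refine Finset.sup_le fun α hα => ?_
  have hcoeff : coeff (α + Finsupp.single i 1) f ≠ 0 := fun h =>
    mem_support_iff.mp hα (by rw [coeff_pderiv, h, zero_mul])
  have hdeg : (α + Finsupp.single i 1).degree ≤ f.totalDegree :=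
    le_totalDegree (mem_support_iff.mpr hcoeff)
  rw [map_add, Finsupp.degree_single] at hdeg
  exact Nat.le_sub_of_add_le hdeg

theorem totalDegree_aeval_le [CommSemiring R] {g : σ → MvPolynomial τ R}
    (hg : ∀ i, (g i).totalDegree ≤ 1) (f : MvPolynomial σ R) :
    (aeval g f).totalDegree ≤ f.totalDegree := by
  rw [aeval_def, eval₂_eq]
  refine totalDegree_finsetSum_le fun α hα => ?_
  calc (C (coeff α f) * ∏ i ∈ α.support, g i ^ α i).totalDegree
      ≤ (C (coeff α f)).totalDegree + (∏ i ∈ α.support, g i ^ α i).totalDegree :=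
        totalDegree_mul _ _
    _ ≤ ∑ i ∈ α.support, (g i ^ α i).totalDegree := by
        rw [totalDegree_C, zero_add]
        exact totalDegree_finsetProd _ _
    _ ≤ ∑ i ∈ α.support, α i := Finset.sum_le_sum fun i _ =>
        (totalDegree_pow _ _).trans (mul_le_of_le_one_right' (hg i))
    _ ≤ f.totalDegree := le_totalDegree hα

/- The degree-lexicographically largest monomial among the `q k` has, in the sum of squares, a sum
of squares as its coefficient, so that it cannot cancel. -/
theorem two_mul_totalDegree_le_totalDegree_sum_mul_self {ι : Type*} [CommRing R] [LinearOrder R]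
    [IsStrictOrderedRing R] {s : Finset ι} (q : ι → MvPolynomial σ R) {k : ι} (hk : k ∈ s) :
    2 * (q k).totalDegree ≤ (∑ j ∈ s, q j * q j).totalDegree := by
  cases exists_wellFoundedGT σ
  let m : MonomialOrder σ := MonomialOrder.degLex
  obtain ⟨l, hl, hmax⟩ := s.exists_max_image (fun j => m.toSyn (m.degree (q j))) ⟨k, hk⟩
  have hkl : (q k).totalDegree ≤ (q l).totalDegree := degLex_totalDegree_monotone (hmax k hk)
  obtain h0 | h0 := eq_or_ne (q l) 0
  · rw [h0, totalDegree_zero] at hkl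
    lia
  set α := m.degree (q l)
  have hcoeff : coeff (α + α) (∑ j ∈ s, q j * q j) = ∑ j ∈ s, coeff α (q j) * coeff α (q j) := by
    rw [coeff_sum]
    exact Finset.sum_congr rfl fun j hj => m.coeff_mul_of_add_of_degree_le (hmax j hj) (hmax j hj)
  have hpos : 0 < coeff (α + α) (∑ j ∈ s, q j * q j) := hcoeff ▸
    Finset.sum_pos' (fun j _ => mul_self_nonneg _)
      ⟨l, hl, mul_self_pos.mpr (m.leadingCoeff_ne_zero_iff.mpr h0)⟩
  have hα : α.degree = (q l).totalDegree := degree_degLexDegree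
  have hle : (α + α).degree ≤ (∑ j ∈ s, q j * q j).totalDegree :=
    le_totalDegree (mem_support_iff.mpr hpos.ne')
  rw [map_add, hα] at hle
  lia

end TotalDegree

section Homothety

variable {σ R : Type*} [CommRing R]

/-- The vector `x - p` of polynomials in `x`. -/
def displacement (p : σ → R) : σ → MvPolynomial σ R := fun i => X i - C (p i)

/-- The substitution `f ↦ f (p + t (x - p))`, that is, the composition of polynomials in `x` with
the homothety of ratio `t` centred at `p`. It moves `f` from its value at `p`, for `t = 0`, to
itself, for `t = 1`. -/
def homothety (p : σ → R) (t : R) : MvPolynomial σ R →ₐ[R] MvPolynomial σ R :=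
  aeval fun i => C (p i) + C t * displacement p i

theorem totalDegree_displacement_le (p : σ → R) (i : σ) : (displacement p i).totalDegree ≤ 1 :=
  (totalDegree_sub_C_le _ _).trans ((totalDegree_monomial_le _ _).trans (by simp))

theorem totalDegree_homothety_le (p : σ → R) (t : R) (f : MvPolynomial σ R) :
    (homothety p t f).totalDegree ≤ f.totalDegree := by
  refine totalDegree_aeval_le (fun i => (totalDegree_add _ _).trans (max_le (by simp) ?_)) f
  rw [← smul_eq_C_mul]
  exact (totalDegree_smul_le _ _).trans (totalDegree_displacement_le p i)

@[simp]
theorem homothety_C (p : σ → R) (t a : R) : homothety p t (C a) = C a :=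
  (homothety p t).commutes a

@[simp]
theorem homothety_X (p : σ → R) (t : R) (i : σ) :
    homothety p t (X i) = C (p i) + C t * displacement p i :=
  aeval_X _ i

@[simp]
theorem homothety_zero (p : σ → R) (f : MvPolynomial σ R) : homothety p 0 f = C (eval p f) := by
  induction f using MvPolynomial.induction_on <;> simp_all

@[simp]
theorem homothety_one (p : σ → R) (f : MvPolynomial σ R) : homothety p 1 f = f := by
  simp [homothety, displacement]

end Homothety

section Derivatives

/- The induction on `f` absorbs the factors `X i` into the functional, so `L` has to vary. -/
theorem hasDerivAt_map_homothety {σ : Type*} [Fintype σ] (L : MvPolynomial σ ℝ →ₗ[ℝ] ℝ)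
    (p : σ → ℝ) (f : MvPolynomial σ ℝ) (t : ℝ) :
    HasDerivAt (fun t => L (homothety p t f))
      (L (displacement p ⬝ᵥ fun i => homothety p t (pderiv i f))) t := by
  classical
  induction f using MvPolynomial.induction_on generalizing L with
  | C a => simpa using hasDerivAt_const t (L (C a))
  | add f g hf hg =>
    simpa [dotProduct, mul_add, Finset.sum_add_distrib] using (hf L).fun_add (hg L)
  | mul_X f i hf =>
    have hleibniz : (fun j => homothety p t (pderiv j (f * X i))) =
        (C (p i) + C t * displacement p i) • (fun j => homothety p t (pderiv j f)) +
          Pi.single i (homothety p t f) := by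
      ext1 j
      obtain rfl | hij := eq_or_ne i j
      · simp [mul_comm, add_comm]
      · simp [pderiv_X_of_ne hij, hij, mul_comm]
    have hfun : (fun t => L (homothety p t (f * X i))) = fun t => p i * L (homothety p t f) +
        t * L (homothety p t f * displacement p i) := by
      funext t
      rw [map_mul, homothety_X, mul_add, mul_comm _ (C (p i)), mul_left_comm, C_mul', C_mul',
        map_add, map_smul, map_smul, smul_eq_mul, smul_eq_mul]
    rw [hfun, hleibniz, dotProduct_add, dotProduct_smul, dotProduct_single, smul_eq_mul, add_mul,
      mul_assoc, C_mul', C_mul']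
    simpa [mul_comm, add_assoc, add_comm, add_left_comm] using ((hf L).const_mul (p i)).fun_add
      ((hasDerivAt_id' t).fun_mul (hf (L ∘ₗ LinearMap.mulRight ℝ (displacement p i))))

theorem hasDerivAt_map_dotProduct_homothety_pderiv {d : ℕ} (L : MvPolynomial (Fin d) ℝ →ₗ[ℝ] ℝ)
    (p : Fin d → ℝ) (f : MvPolynomial (Fin d) ℝ) (t : ℝ) :
    HasDerivAt (fun t => L (displacement p ⬝ᵥ fun i => homothety p t (pderiv i f)))
      (L (displacement p ⬝ᵥ (hessian f).map (homothety p t) *ᵥ displacement p)) t := by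
  rw [dotProduct_mulVec, dotProduct_comm]
  simp only [dotProduct, map_sum]
  exact HasDerivAt.fun_sum fun i _ =>
    hasDerivAt_map_homothety (L ∘ₗ LinearMap.mulLeft ℝ (displacement p i)) p (pderiv i f) t

theorem isMinOn_univ_of_hasDerivAt_of_nonneg {f f' f'' : ℝ → ℝ} {a : ℝ}
    (hf : ∀ t, HasDerivAt f (f' t) t) (hf' : ∀ t, HasDerivAt f' (f'' t) t) (hf'' : ∀ t, 0 ≤ f'' t)
    (ha : f' a = 0) : IsMinOn f Set.univ a := by
  have hderiv : deriv f = f' := funext fun t => (hf t).deriv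
  have hconvex : ConvexOn ℝ Set.univ f := by
    refine Monotone.convexOn_univ_of_deriv (fun t => (hf t).differentiableAt) ?_
    exact hderiv ▸ monotone_of_hasDerivAt_nonneg hf' hf''
  refine hconvex.isMinOn_of_rightDeriv_eq_zero (by simp) ?_
  rw [(hf a).hasDerivWithinAt.derivWithin (uniqueDiffWithinAt_Ioi a), ha]

end Derivatives

section Jensen

variable {σ : Type*} {d n : ℕ}

/-- A pseudo-expectation of degree `n`: a functional on polynomials that is normalised and
nonnegative on the squares of degree at most `n`, but need not be integration against a measure.
It is defined on all polynomials, its values in degrees above `n` being unconstrained. -/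
structure IsPseudoExpectation (n : ℕ) (L : MvPolynomial σ ℝ →ₗ[ℝ] ℝ) : Prop where
  map_one : L 1 = 1
  map_mul_self_nonneg : ∀ q : MvPolynomial σ ℝ, 2 * q.totalDegree ≤ n → 0 ≤ L (q * q)

theorem IsPseudoExpectation.map_C {L : MvPolynomial σ ℝ →ₗ[ℝ] ℝ} (hL : IsPseudoExpectation n L)
    (a : ℝ) : L (C a) = a := by
  rw [C_eq_smul_one, map_smul, hL.map_one, smul_eq_mul, mul_one]

theorem isPseudoExpectation_aeval (n : ℕ) (x : σ → ℝ) :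
    IsPseudoExpectation n (aeval x : MvPolynomial σ ℝ →ₐ[ℝ] ℝ).toLinearMap where
  map_one := map_one (aeval x)
  map_mul_self_nonneg q _ := by
    rw [AlgHom.toLinearMap_apply, map_mul]
    exact mul_self_nonneg _

theorem convex_setOf_isPseudoExpectation (n : ℕ) :
    Convex ℝ {L : MvPolynomial σ ℝ →ₗ[ℝ] ℝ | IsPseudoExpectation n L} := by
  intro L hL M hM a b ha hb hab
  refine ⟨by simp [hL.map_one, hM.map_one, hab], fun q hq => ?_⟩
  exact add_nonneg (mul_nonneg ha (hL.map_mul_self_nonneg q hq))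
    (mul_nonneg hb (hM.map_mul_self_nonneg q hq))

theorem two_mul_totalDegree_le_of_hessian_eq {ι : Type*} [Fintype ι]
    {f : MvPolynomial (Fin d) ℝ} {P : Matrix ι (Fin d) (MvPolynomial (Fin d) ℝ)}
    (hP : hessian f = Pᵀ * P) (k : ι) (i : Fin d) :
    2 * (P k i).totalDegree ≤ f.totalDegree - 2 :=
  calc 2 * (P k i).totalDegree ≤ (∑ l, P l i * P l i).totalDegree :=
        two_mul_totalDegree_le_totalDegree_sum_mul_self (fun l => P l i) (Finset.mem_univ k)
    _ = (pderiv i (pderiv i f)).totalDegree := congrArg totalDegree (congrFun₂ hP i i).symm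
    _ ≤ f.totalDegree - 1 - 1 := (totalDegree_pderiv_le _ _).trans
        (Nat.sub_le_sub_right (totalDegree_pderiv_le _ _) 1)

theorem IsPseudoExpectation.map_dotProduct_hessian_homothety_nonneg
    {L : MvPolynomial (Fin d) ℝ →ₗ[ℝ] ℝ} (hL : IsPseudoExpectation n L) (hn : 2 ≤ n)
    {f : MvPolynomial (Fin d) ℝ} (hf : IsSOSConvex f) (hdeg : f.totalDegree ≤ n)
    (p : Fin d → ℝ) (t : ℝ) :
    0 ≤ L (displacement p ⬝ᵥ (hessian f).map (homothety p t) *ᵥ displacement p) := by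
  obtain ⟨ν, P, hP⟩ := hf
  set w := P.map (homothety p t) *ᵥ displacement p
  have hsos : displacement p ⬝ᵥ (hessian f).map (homothety p t) *ᵥ displacement p = w ⬝ᵥ w := by
    rw [hP, Matrix.map_mul, transpose_map, ← mulVec_mulVec, dotProduct_mulVec, vecMul_transpose]
  have hdegw (k : Fin ν) : (w k).totalDegree ≤ n / 2 := by
    refine totalDegree_finsetSum_le fun i _ => ?_
    have hPki := two_mul_totalDegree_le_of_hessian_eq hP k i
    calc (homothety p t (P k i) * displacement p i).totalDegree
        ≤ (homothety p t (P k i)).totalDegree + (displacement p i).totalDegree :=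
          totalDegree_mul _ _
      _ ≤ (P k i).totalDegree + 1 :=
          add_le_add (totalDegree_homothety_le p t _) (totalDegree_displacement_le p i)
      _ ≤ n / 2 := by lia
  rw [hsos, dotProduct, map_sum]
  exact Finset.sum_nonneg fun k _ =>
    hL.map_mul_self_nonneg _ ((Nat.mul_le_mul_left 2 (hdegw k)).trans (Nat.mul_div_le n 2))

theorem IsSOSConvex.eval_le_map {f : MvPolynomial (Fin d) ℝ} (hf : IsSOSConvex f)
    (hn : 2 ≤ n) (hdeg : f.totalDegree ≤ n) {L : MvPolynomial (Fin d) ℝ →ₗ[ℝ] ℝ}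
    (hL : IsPseudoExpectation n L) : eval (fun i => L (X i)) f ≤ L f := by
  set p : Fin d → ℝ := fun i => L (X i)
  have hcritical : L (displacement p ⬝ᵥ fun i => homothety p 0 (pderiv i f)) = 0 := by
    simp only [homothety_zero, dotProduct, displacement, map_sum, mul_comm _ (C _), C_mul',
      map_smul, map_sub, hL.map_C]
    simp [p]
  have hmin := isMinOn_univ_of_hasDerivAt_of_nonneg (hasDerivAt_map_homothety L p f)
    (hasDerivAt_map_dotProduct_homothety_pderiv L p f)
    (hL.map_dotProduct_hessian_homothety_nonneg hn hf hdeg p) hcritical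
  simpa [hL.map_C] using hmin (Set.mem_univ 1)

theorem IsSOSConvex.convexOn_eval {f : MvPolynomial (Fin d) ℝ} (hf : IsSOSConvex f) :
    ConvexOn ℝ Set.univ fun x : Fin d → ℝ => eval x f := by
  refine ⟨convex_univ, fun x _ z _ a b ha hb hab => ?_⟩
  simpa [aeval_eq_eval] using! hf.eval_le_map (le_max_left 2 _) (le_max_right _ _)
    (convex_setOf_isPseudoExpectation _ (isPseudoExpectation_aeval _ x)
      (isPseudoExpectation_aeval _ z) ha hb hab)

end Jensen

section Projection

variable {d s : ℕ}

theorem convex_feasibleSet {g : Fin s → MvPolynomial (Fin d) ℝ} (hg : ∀ j, IsSOSConvex (g j)) :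
    Convex ℝ (feasibleSet g) := fun _ hx _ hz _ _ ha hb hab j =>
  ((hg j).convexOn_eval.convex_le 0 ⟨Set.mem_univ _, hx j⟩ ⟨Set.mem_univ _, hz j⟩ ha hb hab).2

theorem subsingleton_projectionSet {D : Set (EuclideanSpace ℝ (Fin d))} (hD : Convex ℝ D)
    (v : EuclideanSpace ℝ (Fin d)) : (projectionSet D v).Subsingleton := by
  rintro p ⟨hpD, hp⟩ z ⟨hzD, hz⟩
  by_contra hne
  have hzp : ‖v - z‖ ≤ ‖v - p‖ := le_of_sq_le_sq (hz p hpD) (norm_nonneg _)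
  have hmid : (1 / 2 : ℝ) • p + (1 / 2 : ℝ) • z ∈ Metric.ball v ‖v - p‖ :=
    combo_mem_ball_of_ne (mem_closedBall_iff_norm'.mpr le_rfl) (mem_closedBall_iff_norm'.mpr hzp)
      hne (by norm_num) (by norm_num) (by norm_num)
  have hmem := hD hpD hzD (by norm_num) (by norm_num) (add_halves (1 : ℝ))
  exact (hp _ hmem).not_gt (by gcongr; exact mem_ball_iff_norm'.mp hmid)

theorem totalDegree_distSqPoly_le (v : EuclideanSpace ℝ (Fin d)) :
    (distSqPoly v).totalDegree ≤ 2 :=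
  totalDegree_finsetSum_le fun i _ => (totalDegree_pow _ 2).trans
    (Nat.mul_le_mul_left 2 (totalDegree_displacement_le v i))

theorem pderiv_distSqPoly (v : EuclideanSpace ℝ (Fin d)) (i : Fin d) :
    pderiv i (distSqPoly v) = 2 • (X i - C (v i)) := by
  simp [distSqPoly, pderiv_X, Pi.single_apply]

theorem isSOSConvex_distSqPoly (v : EuclideanSpace ℝ (Fin d)) : IsSOSConvex (distSqPoly v) := by
  refine ⟨d, diagonal fun _ => C √2, ?_⟩
  rw [diagonal_transpose, diagonal_mul_diagonal]
  ext1 i j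
  rw [← C_mul, Real.mul_self_sqrt zero_le_two, map_ofNat, hessian, of_apply, pderiv_distSqPoly,
    map_nsmul]
  simp [pderiv_X, diagonal_apply, Pi.single_apply, eq_comm]

end Projection

section MomentProgram

variable {d n s ω : ℕ}

theorem support_subset_multiIdx {f : MvPolynomial (Fin d) ℝ} (hf : f.totalDegree ≤ n) :
    f.support ⊆ multiIdx d n := fun α hα =>
  (mem_multiIdx α).mpr <| (Finsupp.degree_eq_sum α).symm.trans_le ((le_totalDegree hα).trans hf)

theorem sum_multiIdx_monomial_coeff {f : MvPolynomial (Fin d) ℝ} (hf : f.totalDegree ≤ n) :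
    ∑ α : multiIdx d n, monomial (α : Fin d →₀ ℕ) (coeff (α : Fin d →₀ ℕ) f) = f := by
  rw [Finset.sum_coe_sort (multiIdx d n) fun α => monomial α (coeff α f),
    ← Finset.sum_subset (support_subset_multiIdx hf), support_sum_monomial_coeff]
  simp +contextual

theorem add_mem_multiIdx (β γ : multiIdx d (ω / 2)) :
    (β : Fin d →₀ ℕ) + (γ : Fin d →₀ ℕ) ∈ multiIdx d ω := by
  have hβ := (mem_multiIdx _).mp β.2
  have hγ := (mem_multiIdx _).mp γ.2
  rw [mem_multiIdx]
  simp only [Finsupp.add_apply, Finset.sum_add_distrib]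
  lia

/-- The Riesz functional `f ↦ riesz y f` as a linear map. -/
def rieszFunctional (y : multiIdx d ω → ℝ) : MvPolynomial (Fin d) ℝ →ₗ[ℝ] ℝ :=
  ∑ α : multiIdx d ω, y α • lcoeff ℝ (α : Fin d →₀ ℕ)

theorem rieszFunctional_apply (y : multiIdx d ω → ℝ) (f : MvPolynomial (Fin d) ℝ) :
    rieszFunctional y f = riesz y f := by
  simp [rieszFunctional, riesz, mul_comm]

theorem rieszFunctional_monomial (y : multiIdx d ω → ℝ) {α : Fin d →₀ ℕ} (hα : α ∈ multiIdx d ω)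
    (a : ℝ) : rieszFunctional y (monomial α a) = a * y ⟨α, hα⟩ := by
  rw [rieszFunctional_apply, riesz, Finset.sum_eq_single ⟨α, hα⟩] <;>
    simp +contextual [coeff_monomial, Subtype.ext_iff, eq_comm]

/-- The moment matrix `∑_α y_α B_α`. -/
abbrev momentMatrix (y : multiIdx d ω → ℝ) :
    Matrix (multiIdx d (ω / 2)) (multiIdx d (ω / 2)) ℝ :=
  ∑ α : multiIdx d ω, y α • momentBasis (ω / 2) (α : Fin d →₀ ℕ)

theorem momentMatrix_apply (y : multiIdx d ω → ℝ) (β γ : multiIdx d (ω / 2)) :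
    momentMatrix y β γ = y ⟨β + γ, add_mem_multiIdx β γ⟩ := by
  rw [momentMatrix, Matrix.sum_apply, Finset.sum_eq_single ⟨β + γ, add_mem_multiIdx β γ⟩] <;>
    simp +contextual [momentBasis, Subtype.ext_iff, eq_comm]

theorem rieszFunctional_mul_self (y : multiIdx d ω → ℝ) {q : MvPolynomial (Fin d) ℝ}
    (hq : q.totalDegree ≤ ω / 2) :
    rieszFunctional y (q * q) =
      (fun β : multiIdx d (ω / 2) => coeff (β : Fin d →₀ ℕ) q) ⬝ᵥ
        momentMatrix y *ᵥ fun β : multiIdx d (ω / 2) => coeff (β : Fin d →₀ ℕ) q := by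
  conv_lhs => rw [← sum_multiIdx_monomial_coeff hq, Finset.sum_mul_sum]
  simp only [map_sum, monomial_mul, rieszFunctional_monomial y (add_mem_multiIdx _ _), dotProduct,
    mulVec, momentMatrix_apply, Finset.mul_sum]
  refine Finset.sum_congr rfl fun β _ => Finset.sum_congr rfl fun γ _ => ?_
  ring

theorem isPseudoExpectation_rieszFunctional {y : multiIdx d ω → ℝ}
    (hpsd : (momentMatrix y).PosSemidef) (hy0 : y ⟨0, zero_mem_multiIdx d ω⟩ = 1) :
    IsPseudoExpectation ω (rieszFunctional y) where
  map_one := by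
    rw [← C_1, C_apply, rieszFunctional_monomial y (zero_mem_multiIdx d ω), hy0, one_mul]
  map_mul_self_nonneg q hq := by
    rw [rieszFunctional_mul_self y (by lia)]
    simpa using hpsd.dotProduct_mulVec_nonneg fun β => coeff (β : Fin d →₀ ℕ) q

/-- The moments `x^α`, for `|α| ≤ ω`, of the unit mass at `x`. -/
def pointMoments (ω : ℕ) (x : Fin d → ℝ) : multiIdx d ω → ℝ :=
  fun α => (α : Fin d →₀ ℕ).prod fun i k => x i ^ k

theorem riesz_pointMoments (x : Fin d → ℝ) {f : MvPolynomial (Fin d) ℝ}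
    (hf : f.totalDegree ≤ ω) : riesz (pointMoments ω x) f = eval x f := by
  conv_rhs => rw [← sum_multiIdx_monomial_coeff hf, map_sum]
  simp only [riesz, pointMoments, eval_monomial]

theorem momentMatrix_pointMoments (x : Fin d → ℝ) :
    momentMatrix (pointMoments ω x) =
      vecMulVec (pointMoments (ω / 2) x) (pointMoments (ω / 2) x) := by
  ext β γ
  rw [momentMatrix_apply]
  exact Finsupp.prod_add_index' (fun _ => pow_zero _) fun _ => pow_add _

theorem pointMoments_mem_momentFeasible {g : Fin s → MvPolynomial (Fin d) ℝ}
    (hdeg : ∀ j, (g j).totalDegree ≤ ω) {x : EuclideanSpace ℝ (Fin d)} (hx : x ∈ feasibleSet g) :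
    pointMoments ω x ∈ momentFeasible g ω := by
  refine ⟨fun j => (riesz_pointMoments _ (hdeg j)).trans_le (hx j), ?_, by simp [pointMoments]⟩
  change (momentMatrix _).PosSemidef
  rw [momentMatrix_pointMoments]
  exact posSemidef_vecMulVec_self_star _

/-- The vector `(y_{e_1}, …, y_{e_d})` of first moments. -/
def firstMoments (hω : 2 ≤ ω) (y : multiIdx d ω → ℝ) : EuclideanSpace ℝ (Fin d) :=
  WithLp.toLp 2 fun i => y ⟨Finsupp.single i 1, single_mem_multiIdx hω i⟩

theorem rieszFunctional_X (hω : 2 ≤ ω) (y : multiIdx d ω → ℝ) (i : Fin d) :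
    rieszFunctional y (X i) = firstMoments hω y i := by
  rw [X, rieszFunctional_monomial y (single_mem_multiIdx hω i), one_mul, firstMoments]

theorem IsSOSConvex.eval_firstMoments_le_riesz {f : MvPolynomial (Fin d) ℝ} (hf : IsSOSConvex f)
    (hω : 2 ≤ ω) (hdeg : f.totalDegree ≤ ω) {y : multiIdx d ω → ℝ}
    (hy : IsPseudoExpectation ω (rieszFunctional y)) :
    eval (fun i => firstMoments hω y i) f ≤ riesz y f := by
  simpa only [rieszFunctional_X hω, rieszFunctional_apply] using hf.eval_le_map hω hdeg hy

end MomentProgram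

end

end SOSProj

open SOSProj MvPolynomial in
theorem mainTheorem1_general {d s ω : ℕ} (v : EuclideanSpace ℝ (Fin d))
    {g : Fin s → MvPolynomial (Fin d) ℝ} (hg : ∀ j, IsSOSConvex (g j)) (hω : 2 ≤ ω)
    (hdeg : ∀ j, (g j).totalDegree ≤ ω) {y : multiIdx d ω → ℝ}
    (hy : IsMomentSolution g v ω y) :
    projectionSet (feasibleSet g) v = {firstMoments hω y} := by
  obtain ⟨hfeasible, hoptimal⟩ := hy
  have hriesz := isPseudoExpectation_rieszFunctional hfeasible.2.1 hfeasible.2.2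
  have hdist := (totalDegree_distSqPoly_le v).trans hω
  refine (subsingleton_projectionSet (convex_feasibleSet hg) v).eq_singleton_of_mem
    ⟨fun j => ?_, fun x hx => ?_⟩
  · exact ((hg j).eval_firstMoments_le_riesz hω (hdeg j) hriesz).trans (hfeasible.1 j)
  · calc ‖v - firstMoments hω y‖ ^ 2
        = eval (fun i => firstMoments hω y i) (distSqPoly v) := by
          rw [eval_distSqPoly, norm_sub_rev]
      _ ≤ riesz y (distSqPoly v) :=
          (isSOSConvex_distSqPoly v).eval_firstMoments_le_riesz hω hdist hriesz
      _ ≤ riesz (pointMoments ω x) (distSqPoly v) :=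
          hoptimal _ (pointMoments_mem_momentFeasible hdeg hx)
      _ = ‖v - x‖ ^ 2 := by rw [riesz_pointMoments _ hdist, eval_distSqPoly, norm_sub_rev]

theorem mainTheorem1 (d s : ℕ) (v : EuclideanSpace ℝ (Fin d))
    (g : Fin s → MvPolynomial (Fin d) ℝ) (hg : ∀ j, SOSProj.IsSOSConvex (g j))
    (ω : ℕ) (hω : IsLeast {n : ℕ | Even n ∧ 2 ≤ n ∧ ∀ j, (g j).totalDegree ≤ n} ω)
    (hdual : ∃ μ : ℝ, IsGreatest (SOSProj.sosValues g v ω) μ ∧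
      IsLeast (SOSProj.momentValues g v ω) μ)
    (y : SOSProj.multiIdx d ω → ℝ) (hy : SOSProj.IsMomentSolution g v ω y) :
    SOSProj.projectionSet (SOSProj.feasibleSet g) v =
      {WithLp.toLp 2 fun i : Fin d =>
        y ⟨Finsupp.single i 1, SOSProj.single_mem_multiIdx hω.1.2.1 i⟩} :=
  mainTheorem1_general v hg hω.1.2.1 hω.1.2.2 hy
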